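/- **Setting.** Let $\mathcal X$ be a set and $\mathcal H$ a concept class over $\mathcal X$, i.e. a collection of subsets of $\mathcal X$. $\mathcal H$ *coslices* $X\subseteq\mathcal X$ if for every $x\in X$ there are $h_x^+,h_x^-\in\mathcal H$ with $X\cap h_x^+=\{x\}$ and $X\cap h_x^-=X\setminus\{x\}$. The *coslicing dimension* is $\operatorname{cosl}(\mathcal H)=\sup\{|X| : X \text{ is cosliced by } \mathcal H\}\in\mathbb N\cup\{\infty\}$. For $k\ge 1$, an $n$-point *instance* consists of a set $X\subseteq\mathcal X$ of $n<\infty$ points and a latent clustering $\mathcal C=(C_1,\dots,C_k)$ of $X$, a $k$-tuple of pairwise disjoint, possibly empty sets with union $X$; it is *realized by* $\mathcal H$ if for every $i$ there is $h_i\in\mathcal H$ with $C_i=X\cap h_i$. A (randomized) algorithm knows $\mathcal H$ and $k$, receives $X$, adaptively queries points of $X$, receiving for each queried point the index of its cluster, and finally outputs a clustering of $X$; its cost is the number of queries. **Theorem.** 1. For every $a>0$ there is a constant $K_a$, depending only on $a$, such that the following holds for all $\mathcal X$, $\mathcal H$ and $k\ge1$ with $\operatorname{cosl}(\mathcal H)<\infty$.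 There is a randomized algorithm (not depending on $a$) that, on every instance whose latent clustering $\mathcal C$ is realized by $\mathcal H$, always outputs $\mathcal C$ and, if the number $n$ of points is at least $2$, for every $a>0$ makes at most $K_a\operatorname{cosl}(\mathcal H)\,k\log k\,\log n$ queries with probability at least $1-n^{-a}$. 2. For every $p>\tfrac12$ there is a constant $c>0$, depending only on $p$, such that the following holds for every $\mathcal X$, every $\mathcal H$, and every randomized algorithm $\mathcal A$ for $k=2$ that, on every instance whose latent clustering is realized by $\mathcal H$, outputs the latent clustering with probability at least $p$: (a) if $\mathcal H\neq\emptyset$ and $\operatorname{cosl}(\mathcal H)<\infty$, then there is an instance on exactly $\operatorname{cosl}(\mathcal H)$ points, with latent clustering realized by $\mathcal H$, on which $\mathcal A$ makes at least $c\cdot\operatorname{cosl}(\mathcal H)$ queries in expectation; (b) if $\operatorname{cosl}(\mathcal H)=\infty$, then for every $n$ there is an $n$-point instance, with latent clustering realized by $\mathcal H$, on which $\mathcal A$ makes at least $c\,n$ queries in expectation. -/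

import Mathlib

open scoped ENNReal

universe u

namespace ActiveClustering

/-- A concept class `H` coslices `X` if for every `x ∈ X` some concept of `H` cuts out `{x}` from `X`
and some concept of `H` cuts out `X \ {x}` from `X`. -/
def Coslices {𝒳 : Type u} (H : Set (Set 𝒳)) (X : Set 𝒳) : Prop :=
  ∀ x ∈ X, (∃ h ∈ H, X ∩ h = {x}) ∧ (∃ h ∈ H, X ∩ h = X \ {x})

/-- The coslicing dimension: the supremum of the cardinalities of the cosliced sets,
`⊤` if arbitrarily large sets are cosliced. -/
noncomputable def cosl {𝒳 : Type u} (H : Set (Set 𝒳)) : ℕ∞ :=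
  ⨆ (X : Set 𝒳) (_ : Coslices H X), X.encard

/-- A clustering of the finite set `X`, i.e. a `k`-tuple of pairwise disjoint, possibly empty sets
with union `X`, given by the map that sends a point to the index of its cluster. -/
abbrev Clustering {𝒳 : Type u} (X : Finset 𝒳) (k : ℕ) : Type u := {x // x ∈ X} → Fin k

/-- The `i`-th cluster, as a subset of the domain. -/
def Clustering.cluster {𝒳 : Type u} {X : Finset 𝒳} {k : ℕ} (C : Clustering X k) (i : Fin k) :
    Set 𝒳 :=
  {x | ∃ hx : x ∈ X, C ⟨x, hx⟩ = i}

/-- Every cluster is the trace on `X` of some concept of `H`. -/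
def RealizedBy {𝒳 : Type u} {X : Finset 𝒳} {k : ℕ} (H : Set (Set 𝒳)) (C : Clustering X k) :
    Prop :=
  ∀ i : Fin k, ∃ h ∈ H, C.cluster i = (X : Set 𝒳) ∩ h

/-- A deterministic adaptive strategy on the point set `X`: either stop and return a clustering, or
query the label of a point of `X` and continue depending on the answer. -/
inductive Strategy {𝒳 : Type u} (X : Finset 𝒳) (k : ℕ) : Type u
  | answer (C : Clustering X k) : Strategy X k
  | query (x : {x // x ∈ X}) (next : Fin k → Strategy X k) : Strategy X k

/-- The clustering returned when the label oracle is consistent with the latent clustering `C`. -/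
def Strategy.result {𝒳 : Type u} {X : Finset 𝒳} {k : ℕ} (C : Clustering X k) :
    Strategy X k → Clustering X k
  | .answer D => D
  | .query x next => (next (C x)).result C

/-- The number of queries made when the label oracle is consistent with `C`
(repeated queries of the same point are all counted). -/
def Strategy.numQueries {𝒳 : Type u} {X : Finset 𝒳} {k : ℕ} (C : Clustering X k) :
    Strategy X k → ℕ
  | .answer _ => 0
  | .query x next => (next (C x)).numQueries C + 1

/-- A randomized algorithm for `k` clusters: on the input `X` it follows a random strategy. -/
abbrev Algorithm (𝒳 : Type u) (k : ℕ) : Type u := (X : Finset 𝒳) → PMF (Strategy X k)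

/-- The probability that the strategy drawn by the algorithm on `X` satisfies `P`. -/
noncomputable def Algorithm.prob {𝒳 : Type u} {k : ℕ} (A : Algorithm 𝒳 k) (X : Finset 𝒳)
    (P : Strategy X k → Prop) : ℝ≥0∞ :=
  (A X).toOuterMeasure {s | P s}

/-- The expected number of queries on the instance with latent clustering `C`. -/
noncomputable def Algorithm.expectedQueries {𝒳 : Type u} {k : ℕ} (A : Algorithm 𝒳 k)
    {X : Finset 𝒳} (C : Clustering X k) : ℝ≥0∞ :=
  ∑' s : Strategy X k, A X s * (s.numQueries C : ℝ≥0∞)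

/-- On every instance whose latent clustering is realized by `H`, the algorithm returns the latent
clustering with probability at least `p`. -/
def Algorithm.Recovers {𝒳 : Type u} {k : ℕ} (A : Algorithm 𝒳 k) (H : Set (Set 𝒳)) (p : ℝ) :
    Prop :=
  ∀ (X : Finset 𝒳) (C : Clustering X k), RealizedBy H C →
    ENNReal.ofReal p ≤ A.prob X (fun s => s.result C = C)

end ActiveClustering

namespace ActiveClustering

/-! Upper bound: the points are processed in uniformly random order, and a label is queried only if
the realized clusterings consistent with the answers so far disagree on it. The answer is then
always correct. If `S` is the set of points up to and including `x`, a query of `x` forces `x` to be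
critical in `S`: some realized clustering agrees with `C` on `S \ {x}` but not at `x`. Critical
points sharing a label form a cosliced set (`coslices_criticalPoints_filter`), so `S` has at most `d
= k * cosl H` of them. In backward analysis the last point of a random order of `S` is uniform in
`S`, hence critical with probability at most `d / |S|`, whatever comes later. Multiplying the
factors `1 + d / m` bounds the mean of `2 ^ N`, for `N` the number of queries, by `exp (d * harmonic
n)` (`tsum_randomOrder_two_pow_le`), and Markov's inequality gives the tail for every `a` at once.

Lower bound: on a cosliced set every split into a singleton and its complement is realized. Finding
the hidden singleton needs linearly many queries, since nearly every query returns the majority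
label (`card_filter_result_singletonClustering_le`); averaging over the hidden point handles
randomization. One-point sets are treated separately. -/

open Classical in
/-- Process the points of the list in order, starting from the version space `V`: the label of a
point is queried only if the clusterings that are still possible disagree on it. -/
noncomputable def versionSpaceStrategy {𝒳 : Type u} {X : Finset 𝒳} {k : ℕ} (D₀ : Clustering X k) :
    List {x // x ∈ X} → Set (Clustering X k) → Strategy X k
  | [], V => .answer (if h : V.Nonempty then h.some else D₀)
  | x :: l, V =>
    if ∀ D ∈ V, ∀ D' ∈ V, D x = D' x then versionSpaceStrategy D₀ l V
    else .query x fun i => versionSpaceStrategy D₀ l {D ∈ V | D x = i}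

/-! ### Correctness of the strategy, and critical points as the source of its queries. -/

section VersionSpace

variable {𝒳 : Type u} {X : Finset 𝒳} {k : ℕ} (D₀ : Clustering X k)

theorem result_versionSpaceStrategy (C : Clustering X k) (l : List {x // x ∈ X})
    (V : Set (Clustering X k)) (hC : C ∈ V)
    (hV : ∀ D ∈ V, (∀ y ∈ l, D y = C y) → D = C) :
    (versionSpaceStrategy D₀ l V).result C = C := by
  induction l generalizing V with
  | nil =>
    have hne : V.Nonempty := ⟨C, hC⟩
    simp only [versionSpaceStrategy, hne, dite_true, Strategy.result]
    exact hV _ hne.some_mem (by simp)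
  | cons x l ih =>
    rw [versionSpaceStrategy]
    split_ifs with hx
    · refine ih V hC fun D hD h => hV D hD fun y hy => ?_
      rcases List.mem_cons.1 hy with rfl | hy
      · exact hx D hD C hC
      · exact h y hy
    · refine ih _ ⟨hC, rfl⟩ fun D hD h => hV D hD.1 fun y hy => ?_
      rcases List.mem_cons.1 hy with rfl | hy
      · exact hD.2
      · exact h y hy

-- The strategy consumes the list from the front, while backward analysis removes points from the
-- end; this lemma reconciles the two.
open Classical in
theorem numQueries_versionSpaceStrategy_append (C : Clustering X k) (l : List {x // x ∈ X})
    (x : {x // x ∈ X}) (V : Set (Clustering X k)) (hC : C ∈ V) :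
    (versionSpaceStrategy D₀ (l ++ [x]) V).numQueries C ≤
      (versionSpaceStrategy D₀ l V).numQueries C +
        if ∃ D ∈ V, (∀ y ∈ l, D y = C y) ∧ D x ≠ C x then 1 else 0 := by
  induction l generalizing V with
  | nil =>
    by_cases hx : ∀ D ∈ V, ∀ D' ∈ V, D x = D' x
    · simp only [List.nil_append, versionSpaceStrategy, if_pos hx]
      exact Nat.le_add_right _ _
    · have : ∃ D ∈ V, D x ≠ C x := by
        by_contra! h
        exact hx fun D hD D' hD' => (h D hD).trans (h D' hD').symm
      simp only [List.nil_append, versionSpaceStrategy, if_neg hx, Strategy.numQueries]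
      simp [this]
  | cons z l ih =>
    rw [List.cons_append, versionSpaceStrategy, versionSpaceStrategy]
    split_ifs with hz h h
    · simpa using (ih V hC).trans (Nat.add_le_add_left (by split_ifs <;> simp) _)
    · refine (ih V hC).trans (Nat.add_le_add_left ?_ _)
      rw [if_neg]
      rintro ⟨D, hD, hl, hx⟩
      refine h ⟨D, hD, fun y hy => ?_, hx⟩
      rcases List.mem_cons.1 hy with rfl | hy
      · exact hz D hD C hC
      · exact hl y hy
    · have := ih {D ∈ V | D z = C z} ⟨hC, rfl⟩
      simp only [Strategy.numQueries]
      have h1 := this.trans (Nat.add_le_add_left (by split_ifs <;> simp : _ ≤ 1) _)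
      omega
    · have := ih {D ∈ V | D z = C z} ⟨hC, rfl⟩
      simp only [Strategy.numQueries]
      rw [if_neg] at this
      · omega
      rintro ⟨D, hD, hl, hx⟩
      refine h ⟨D, hD.1, fun y hy => ?_, hx⟩
      rcases List.mem_cons.1 hy with rfl | hy
      · exact hD.2
      · exact hl y hy

open Classical in
/-- The points of `S` whose label in `C` is not determined by the labels of the other points
of `S`, among the clusterings in `V`. -/
noncomputable def criticalPoints (V : Set (Clustering X k)) (C : Clustering X k)
    (S : Finset {x // x ∈ X}) : Finset {x // x ∈ X} :=
  {x ∈ S | ∃ D ∈ V, (∀ y ∈ S, y ≠ x → D y = C y) ∧ D x ≠ C x}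

theorem mem_criticalPoints {V : Set (Clustering X k)} {C : Clustering X k}
    {S : Finset {x // x ∈ X}} {x : {x // x ∈ X}} :
    x ∈ criticalPoints V C S ↔
      x ∈ S ∧ ∃ D ∈ V, (∀ y ∈ S, y ≠ x → D y = C y) ∧ D x ≠ C x := by
  simp [criticalPoints]

theorem numQueries_versionSpaceStrategy_eq_zero (C : Clustering X k) (V : Set (Clustering X k))
    (hC : C ∈ V) (h : ∀ S, criticalPoints V C S = ∅) (l : List {x // x ∈ X}) :
    (versionSpaceStrategy D₀ l V).numQueries C = 0 := by
  classical
  induction l using List.reverseRecOn with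
  | nil => rfl
  | append_singleton l x ih =>
    have := numQueries_versionSpaceStrategy_append D₀ C l x V hC
    rw [ih, if_neg] at this
    · omega
    rintro ⟨D, hD, hl, hx⟩
    have hmem : x ∈ criticalPoints V C (insert x l.toFinset) :=
      mem_criticalPoints.2 ⟨by simp, D, hD, fun y hy hyx => hl y (by simpa [hyx] using hy), hx⟩
    simp [h] at hmem

theorem Coslices.mono {H : Set (Set 𝒳)} {Y Z : Set 𝒳} (hZ : Coslices H Z) (hYZ : Y ⊆ Z) :
    Coslices H Y := by
  intro x hx
  obtain ⟨⟨h, hh, he⟩, g, hg, ge⟩ := hZ x (hYZ hx)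
  refine ⟨⟨h, hh, ?_⟩, g, hg, ?_⟩
  · ext y
    have := Set.ext_iff.1 he y
    have := @hYZ y
    simp only [Set.mem_inter_iff, Set.mem_singleton_iff] at *
    grind
  · ext y
    have := Set.ext_iff.1 ge y
    have := @hYZ y
    simp only [Set.mem_inter_iff, Set.mem_sdiff, Set.mem_singleton_iff] at *
    grind

theorem Coslices.encard_le_cosl {H : Set (Set 𝒳)} {Z : Set 𝒳} (hZ : Coslices H Z) :
    Z.encard ≤ cosl H :=
  le_iSup₂_of_le Z hZ le_rfl

theorem RealizedBy.exists_mem_iff {H : Set (Set 𝒳)} {D : Clustering X k} (hD : RealizedBy H D)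
    (i : Fin k) : ∃ h ∈ H, ∀ y : {x // x ∈ X}, (y : 𝒳) ∈ h ↔ D y = i := by
  obtain ⟨h, hh, he⟩ := hD i
  refine ⟨h, hh, fun y => ?_⟩
  have := Set.ext_iff.1 he (y : 𝒳)
  simpa [Clustering.cluster] using this.symm

/-- A witness `D` for `x` changes only the label of `x` among the critical points. Within the class
of label `i`, the concept of `D` for its new label `D x` therefore cuts out `{x}`, and its concept
for the old label `i` cuts out everything except `x`. -/
theorem coslices_criticalPoints_filter (H : Set (Set 𝒳))
    (C : Clustering X k) (S : Finset {x // x ∈ X}) (i : Fin k) :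
    Coslices H (Subtype.val ''
      ({x ∈ criticalPoints {D | RealizedBy H D} C S | C x = i} : Set {x // x ∈ X})) := by
  rintro _ ⟨x, ⟨hx, rfl⟩, rfl⟩
  obtain ⟨hxS, D, hD, hag, hne⟩ := mem_criticalPoints.1 hx
  obtain ⟨h, hh, he⟩ := RealizedBy.exists_mem_iff hD (D x)
  obtain ⟨g, hg, ge⟩ := RealizedBy.exists_mem_iff hD (C x)
  have key : ∀ y ∈ criticalPoints {D | RealizedBy H D} C S, y ≠ x → D y = C y :=
    fun y hy => hag y (mem_criticalPoints.1 hy).1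
  refine ⟨⟨h, hh, ?_⟩, g, hg, ?_⟩
  · ext z
    constructor
    · rintro ⟨⟨y, ⟨hy, hyx⟩, rfl⟩, hz⟩
      by_contra hne'
      have hyx' : y ≠ x := fun e => hne' (by rw [e]; rfl)
      have h1 := key y hy hyx'
      have h2 := (he y).1 hz
      exact hne (by rw [← h2, h1, hyx])
    · rintro rfl
      exact ⟨⟨x, ⟨hx, rfl⟩, rfl⟩, (he x).2 rfl⟩
  · ext z
    constructor
    · rintro ⟨⟨y, ⟨hy, hyx⟩, rfl⟩, hz⟩
      refine ⟨⟨y, ⟨hy, hyx⟩, rfl⟩, fun e => ?_⟩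
      have e' : y = x := Subtype.ext e
      subst e'
      exact hne ((ge y).1 hz)
    · rintro ⟨⟨y, ⟨hy, hyx⟩, rfl⟩, hz⟩
      refine ⟨⟨y, ⟨hy, hyx⟩, rfl⟩, (ge y).2 ?_⟩
      rw [key y hy fun e => hz (by rw [e]; rfl), hyx]

theorem card_criticalPoints_le (H : Set (Set 𝒳)) (hH : cosl H < ⊤)
    (C : Clustering X k) (S : Finset {x // x ∈ X}) :
    (criticalPoints {D | RealizedBy H D} C S).card ≤ k * (cosl H).toNat := by
  classical
  set B := criticalPoints {D | RealizedBy H D} C S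
  have hcard : ∀ i ∈ (Finset.univ : Finset (Fin k)), (B.filter fun x => C x = i).card ≤
      (cosl H).toNat := by
    intro i _
    have h := (coslices_criticalPoints_filter H C S i).encard_le_cosl
    rw [Function.Injective.encard_image Subtype.val_injective] at h
    have e : ({x ∈ criticalPoints {D | RealizedBy H D} C S | C x = i} : Set {x // x ∈ X}) =
        ((B.filter fun x => C x = i : Finset _) : Set {x // x ∈ X}) := by
      ext; simp [B]
    rw [e, Set.encard_coe_eq_coe_finsetCard] at h
    rw [← ENat.natCast_toNat hH.ne] at h
    exact_mod_cast h
  have := Finset.card_le_mul_card_image_of_maps_to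
    (s := B) (t := (Finset.univ : Finset (Fin k))) (f := C) (by simp) _ hcard
  simpa [mul_comm] using this

theorem criticalPoints_eq_empty_of_subsingleton [Subsingleton (Fin k)]
    (V : Set (Clustering X k)) (C : Clustering X k) (S : Finset {x // x ∈ X}) :
    criticalPoints V C S = ∅ := by
  ext x
  simp only [mem_criticalPoints, Finset.notMem_empty, iff_false]
  rintro ⟨-, D, -, -, h⟩
  exact h (Subsingleton.elim _ _)

end VersionSpace

/-! ### Backward analysis of a random enumeration, and the exponential Markov inequality. -/

section RandomOrder

variable {α : Type u} [DecidableEq α]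

/-- A uniformly random enumeration of `S` (for `n = S.card`), whose last element is drawn first. -/
noncomputable def randomOrder : ℕ → Finset α → PMF (List α)
  | 0, _ => PMF.pure []
  | n + 1, S =>
    if h : S.Nonempty then
      (PMF.uniformOfFinset S h).bind fun x => (randomOrder n (S.erase x)).map fun l => l ++ [x]
    else PMF.pure []

theorem mem_iff_of_mem_support_randomOrder {n : ℕ} {S : Finset α} (hn : S.card = n) {l : List α}
    (hl : l ∈ (randomOrder n S).support) (y : α) : y ∈ l ↔ y ∈ S := by
  induction n generalizing S l with
  | zero =>
    rw [Finset.card_eq_zero] at hn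
    simp_all [randomOrder]
  | succ n ih =>
    have hS : S.Nonempty := Finset.card_pos.1 (by omega)
    rw [randomOrder, dif_pos hS] at hl
    simp only [PMF.mem_support_bind_iff, PMF.mem_support_map_iff,
      PMF.mem_support_uniformOfFinset_iff] at hl
    obtain ⟨x, hx, l', hl', rfl⟩ := hl
    have := ih (by rw [Finset.card_erase_of_mem hx, hn]; rfl) hl'
    by_cases h : y = x <;> simp_all

theorem tsum_bind_mul {β γ : Type*} (p : PMF β) (f : β → PMF γ) (g : γ → ℝ≥0∞) :
    ∑' c, p.bind f c * g c = ∑' b, p b * ∑' c, f b c * g c := by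
  simp_rw [PMF.bind_apply, ← ENNReal.tsum_mul_right, ← ENNReal.tsum_mul_left]
  rw [ENNReal.tsum_comm]
  simp_rw [mul_assoc]

theorem tsum_map_mul {β γ : Type*} (p : PMF β) (f : β → γ) (g : γ → ℝ≥0∞) :
    ∑' c, p.map f c * g c = ∑' b, p b * g (f b) := by
  rw [PMF.map, tsum_bind_mul]
  refine tsum_congr fun b => ?_
  rw [tsum_eq_single (f b)]
  · simp
  · intro c hc
    simp [PMF.pure_apply, hc]

/-- If the last element of an enumeration of `S` increases `N` by at most one, and not at all unless
it belongs to a subset of at most `d` points of `S`, then `2 ^ N` has a small mean. -/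
theorem tsum_randomOrder_two_pow_le (N : List α → ℕ) (B : Finset α → Finset α) (d : ℕ)
    (hB : ∀ S, (B S).card ≤ d) (hBS : ∀ S, B S ⊆ S) (h0 : N [] = 0)
    (hN : ∀ (S : Finset α) (l : List α) (x : α), x ∈ S → (∀ y, y ∈ l ↔ y ∈ S.erase x) →
      N (l ++ [x]) ≤ N l + if x ∈ B S then 1 else 0)
    (n : ℕ) (S : Finset α) (hn : S.card = n) :
    ∑' l, randomOrder n S l * (2 : ℝ≥0∞) ^ N l ≤
      ENNReal.ofReal (Real.exp (d * (harmonic n : ℝ))) := by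
  induction n generalizing S with
  | zero =>
    rw [tsum_eq_single []]
    · simp [randomOrder, h0]
    · intro l hl
      simp [randomOrder, PMF.pure_apply, hl]
  | succ n ih =>
    have hS : S.Nonempty := Finset.card_pos.1 (by omega)
    set E : ℝ≥0∞ := ENNReal.ofReal (Real.exp (d * (harmonic n : ℝ))) with hE
    -- Once the last point `x` is fixed, the rest is a random order of `S.erase x`, and `B S` does
    -- not depend on it; so `x` contributes a factor of at most `2` if it lies in `B S` and `1`
    -- otherwise.
    have hstep : ∀ x ∈ S, ∑' l, (randomOrder n (S.erase x)) l * (2 : ℝ≥0∞) ^ N (l ++ [x]) ≤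
        E * (1 + if x ∈ B S then 1 else 0) := by
      intro x hx
      have hc : (S.erase x).card = n := by rw [Finset.card_erase_of_mem hx, hn]; rfl
      refine le_trans ?_ (mul_le_mul_left (ih _ hc) _)
      rw [← ENNReal.tsum_mul_right]
      refine ENNReal.tsum_le_tsum fun l => ?_
      by_cases hl : l ∈ (randomOrder n (S.erase x)).support
      · rw [mul_assoc]
        gcongr
        refine (pow_le_pow_right₀ (by norm_num)
          (hN S l x hx (mem_iff_of_mem_support_randomOrder hc hl))).trans ?_
        rw [pow_add]
        gcongr
        split_ifs <;> norm_num
      · rw [PMF.mem_support_iff, not_not] at hl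
        simp [hl]
    rw [randomOrder, dif_pos hS, tsum_bind_mul]
    simp_rw [tsum_map_mul]
    rw [tsum_eq_sum (s := S) (fun x hx => by simp [PMF.uniformOfFinset_apply, hx])]
    calc ∑ x ∈ S, (PMF.uniformOfFinset S hS) x *
          ∑' l, (randomOrder n (S.erase x)) l * (2 : ℝ≥0∞) ^ N (l ++ [x])
        ≤ ∑ x ∈ S, ((n + 1 : ℕ) : ℝ≥0∞)⁻¹ * (E * (1 + if x ∈ B S then 1 else 0)) := by
          refine Finset.sum_le_sum fun x hx => ?_
          rw [PMF.uniformOfFinset_apply_of_mem hS hx, hn]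
          gcongr
          exact hstep x hx
      -- Averaging over the uniform last point turns the factors into `1 + |B S| / (n + 1)`, which
      -- is at most `exp (d / (n + 1))`, the next term of the harmonic sum.
      _ = E * (((n + 1 : ℕ) : ℝ≥0∞)⁻¹ * ((n + 1 : ℕ) + (B S).card)) := by
          rw [← Finset.mul_sum, ← Finset.mul_sum, Finset.sum_add_distrib, Finset.sum_ite_mem,
            Finset.inter_eq_right.2 (hBS S)]
          simp [hn]
          ring
      _ ≤ E * ENNReal.ofReal (Real.exp (d / (n + 1))) := by
          gcongr
          have h1 : (((n + 1 : ℕ) : ℝ≥0∞)⁻¹ * ((n + 1 : ℕ) + (B S).card)) =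
              ENNReal.ofReal (((n + 1 : ℕ) : ℝ)⁻¹ * ((n + 1 : ℕ) + (B S).card)) := by
            rw [ENNReal.ofReal_mul (by positivity), ENNReal.ofReal_inv_of_pos (by positivity),
              ENNReal.ofReal_add (by positivity) (by positivity), ENNReal.ofReal_natCast,
              ENNReal.ofReal_natCast]
          rw [h1]
          refine ENNReal.ofReal_le_ofReal ?_
          refine le_trans ?_ (Real.add_one_le_exp _)
          have h2 : ((B S).card : ℝ) ≤ d := by exact_mod_cast hB S
          push_cast
          rw [inv_mul_eq_div, add_div, div_self (by positivity), add_comm]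
          gcongr
      _ = _ := by
          rw [hE, ← ENNReal.ofReal_mul (by positivity), ← Real.exp_add, harmonic_succ]
          push_cast
          congr 2
          ring

/-- Markov's inequality for `2 ^ N`, stated additively to avoid subtraction in `ℝ≥0∞`: for each `s`,
either `N s ≤ T` or `2 ^ (N s - T) ≥ 1`. -/
theorem one_le_toOuterMeasure_add {β : Type*} (p : PMF β) (N : β → ℕ) (T : ℝ) :
    1 ≤ p.toOuterMeasure {s | (N s : ℝ) ≤ T} +
      (∑' s, p s * (2 : ℝ≥0∞) ^ N s) * ENNReal.ofReal (2 ^ (-T)) := by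
  rw [PMF.toOuterMeasure_apply, ← ENNReal.tsum_mul_right, ← ENNReal.tsum_add, ← p.tsum_coe]
  refine ENNReal.tsum_le_tsum fun s => ?_
  by_cases hs : (N s : ℝ) ≤ T
  · rw [Set.indicator_of_mem (by exact hs)]
    exact le_self_add
  · rw [Set.indicator_of_notMem (by exact hs), zero_add, mul_assoc]
    conv_lhs => rw [← mul_one (p s)]
    gcongr
    have h2 : (2 : ℝ≥0∞) ^ N s = ENNReal.ofReal ((2 : ℝ) ^ (N s : ℝ)) := by
      rw [Real.rpow_natCast, ENNReal.ofReal_pow (by norm_num)]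
      norm_num
    rw [h2, ← ENNReal.ofReal_mul (by positivity), ← Real.rpow_add (by norm_num)]
    rw [← ENNReal.ofReal_one]
    exact ENNReal.ofReal_le_ofReal (Real.one_le_rpow (by norm_num) (by linarith))

end RandomOrder

/-! ### The random-order algorithm and its query bound. -/

section UpperBound

variable {𝒳 : Type u} {k : ℕ}

open Classical in
/-- Query the points in a uniformly random order, skipping those whose label can be inferred. -/
noncomputable def randomOrderAlgorithm (H : Set (Set 𝒳)) (i₀ : Fin k) : Algorithm 𝒳 k := fun X =>
  (randomOrder X.card X.attach).map fun l =>
    versionSpaceStrategy (fun _ => i₀) l {D | RealizedBy H D}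

theorem result_randomOrderAlgorithm (H : Set (Set 𝒳)) (i₀ : Fin k) (X : Finset 𝒳)
    (C : Clustering X k) (hC : RealizedBy H C) (s : Strategy X k)
    (hs : s ∈ (randomOrderAlgorithm H i₀ X).support) : s.result C = C := by
  classical
  rw [randomOrderAlgorithm, PMF.mem_support_map_iff] at hs
  obtain ⟨l, hl, rfl⟩ := hs
  refine result_versionSpaceStrategy _ _ _ _ hC fun D _ h => funext fun y => h y ?_
  exact (mem_iff_of_mem_support_randomOrder Finset.card_attach hl y).2 (Finset.mem_attach _ _)

theorem numQueries_randomOrderAlgorithm_eq_zero (H : Set (Set 𝒳)) (i₀ : Fin k) (X : Finset 𝒳)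
    (C : Clustering X k) (hC : RealizedBy H C)
    (hcrit : ∀ S, criticalPoints {D | RealizedBy H D} C S = ∅) (s : Strategy X k)
    (hs : s ∈ (randomOrderAlgorithm H i₀ X).support) : s.numQueries C = 0 := by
  rw [randomOrderAlgorithm, PMF.mem_support_map_iff] at hs
  obtain ⟨l, -, rfl⟩ := hs
  exact numQueries_versionSpaceStrategy_eq_zero _ _ _ hC hcrit l

theorem tsum_randomOrderAlgorithm_two_pow_le (H : Set (Set 𝒳)) (hH : cosl H < ⊤) (i₀ : Fin k)
    (X : Finset 𝒳) (C : Clustering X k) (hC : RealizedBy H C) :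
    ∑' s, randomOrderAlgorithm H i₀ X s * (2 : ℝ≥0∞) ^ s.numQueries C ≤
      ENNReal.ofReal (Real.exp (((k * (cosl H).toNat : ℕ) : ℝ) * (harmonic X.card : ℝ))) := by
  classical
  rw [randomOrderAlgorithm, tsum_map_mul]
  have := tsum_randomOrder_two_pow_le
    (fun l => (versionSpaceStrategy (fun _ => i₀) l {D | RealizedBy H D}).numQueries C)
    (criticalPoints {D | RealizedBy H D} C) (k * (cosl H).toNat)
    (card_criticalPoints_le H hH C) (fun S x hx => (mem_criticalPoints.1 hx).1) rfl ?_
    X.card X.attach Finset.card_attach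
  · convert this
  intro S l x hx hl
  refine (numQueries_versionSpaceStrategy_append _ C l x _ hC).trans
    (Nat.add_le_add_left ?_ _)
  split_ifs with h1 h2 h2
  · exact le_rfl
  · obtain ⟨D, hD, hag, hne⟩ := h1
    refine absurd (mem_criticalPoints.2 ⟨hx, D, hD, fun y hy hyx => hag y ?_, hne⟩) h2
    exact (hl y).2 (Finset.mem_erase.2 ⟨hyx, hy⟩)
  · exact Nat.zero_le _
  · exact le_rfl

theorem prob_randomOrderAlgorithm (H : Set (Set 𝒳)) (hH : cosl H < ⊤) (i₀ : Fin k)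
    (X : Finset 𝒳) (C : Clustering X k) (hC : RealizedBy H C) (hX : 2 ≤ X.card) (a : ℝ)
    (ha : 0 < a) :
    ENNReal.ofReal (1 - (X.card : ℝ) ^ (-a)) ≤
      (randomOrderAlgorithm H i₀).prob X (fun s => (s.numQueries C : ℝ) ≤
        (a + 3) / Real.log 2 ^ 2 * ((cosl H).toNat : ℝ) * (k : ℝ) * Real.log k *
          Real.log X.card) := by
  -- The claimed bound is zero when `k = 1` or `cosl H = 0`. In both cases there are no critical
  -- points and hence no queries; a critical point forces `k ≥ 2` and `d ≥ 1`.
  by_cases hcrit : ∀ S, criticalPoints {D | RealizedBy H D} C S = ∅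
  · have hmem : (randomOrderAlgorithm H i₀ X).support ⊆ {s | (s.numQueries C : ℝ) ≤
        (a + 3) / Real.log 2 ^ 2 * ((cosl H).toNat : ℝ) * (k : ℝ) * Real.log k *
          Real.log X.card} := by
      intro s hs
      rw [Set.mem_ofPred_eq, numQueries_randomOrderAlgorithm_eq_zero H i₀ X C hC hcrit s hs]
      have := Real.log_natCast_nonneg k
      have := Real.log_natCast_nonneg X.card
      push_cast
      positivity
    rw [Algorithm.prob, (PMF.toOuterMeasure_apply_eq_one_iff _ _).2 hmem]
    rw [← ENNReal.ofReal_one]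
    refine ENNReal.ofReal_le_ofReal ?_
    have : (0 : ℝ) ≤ (X.card : ℝ) ^ (-a) := by positivity
    linarith
  push Not at hcrit
  obtain ⟨S, hS⟩ := hcrit
  have hd : 1 ≤ k * (cosl H).toNat :=
    (Finset.card_pos.2 hS).trans_le (card_criticalPoints_le H hH C S)
  have hk : 2 ≤ k := by
    by_contra! hk
    have : Subsingleton (Fin k) := Fin.subsingleton_iff_le_one.2 (by omega)
    rw [criticalPoints_eq_empty_of_subsingleton] at hS
    simp at hS
  set T : ℝ := (a + 3) / Real.log 2 ^ 2 * ((cosl H).toNat : ℝ) * (k : ℝ) * Real.log k *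
          Real.log X.card with hT
  have h := one_le_toOuterMeasure_add (randomOrderAlgorithm H i₀ X) (fun s => s.numQueries C) T
  have htail : (∑' s, randomOrderAlgorithm H i₀ X s * (2 : ℝ≥0∞) ^ s.numQueries C) *
      ENNReal.ofReal (2 ^ (-T)) ≤ ENNReal.ofReal ((X.card : ℝ) ^ (-a)) := by
    refine (mul_le_mul_left (tsum_randomOrderAlgorithm_two_pow_le H hH i₀ X C hC) _).trans ?_
    rw [← ENNReal.ofReal_mul (by positivity)]
    refine ENNReal.ofReal_le_ofReal ?_
    have hn0 : (0 : ℝ) < X.card := by exact_mod_cast (by omega : 0 < X.card)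
    rw [Real.rpow_def_of_pos (by norm_num), Real.rpow_def_of_pos hn0, ← Real.exp_add]
    refine Real.exp_le_exp.2 ?_
    have hharm := harmonic_le_one_add_log X.card
    set d : ℝ := ((k * (cosl H).toNat : ℕ) : ℝ) with hdd
    have hd1 : (1 : ℝ) ≤ d := by rw [hdd]; exact_mod_cast hd
    set L := Real.log X.card with hL
    have hl2 : 0 < Real.log 2 := Real.log_pos (by norm_num)
    have hl2' : (1 : ℝ) / 2 < Real.log 2 := by linarith [Real.log_two_gt_d9]
    have hLn : Real.log 2 ≤ L := Real.log_le_log (by norm_num) (by exact_mod_cast hX)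
    have hLk : Real.log 2 ≤ Real.log k := Real.log_le_log (by norm_num) (by exact_mod_cast hk)
    -- One factor `1 / log 2` in the constant converts base `2` to base `e`; the other pays for `log
    -- k`, which is at least `log 2`.
    have hTd : (a + 3) * d * L ≤ Real.log 2 * T := by
      have : Real.log 2 * T = (a + 3) * d * L * (Real.log k / Real.log 2) := by
        rw [hT, hdd]; push_cast; field_simp
      rw [this]
      have h1 : 1 ≤ Real.log k / Real.log 2 := (one_le_div hl2).2 hLk
      exact le_mul_of_one_le_right (by positivity) h1
    -- `harmonic n ≤ 1 + L ≤ 3 * L` because `L ≥ log 2 > 1 / 2`; this is the `3` in `a + 3`, and the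
    -- `a` yields the failure probability.
    have h1 : d * (harmonic X.card : ℝ) ≤ d * (3 * L) := by
      gcongr
      linarith
    have h2 : a * L ≤ a * (d * L) := by
      gcongr
      exact le_mul_of_one_le_left (by linarith) hd1
    linarith
  rw [ENNReal.ofReal_sub _ (by positivity), ENNReal.ofReal_one]
  exact tsub_le_iff_right.2 (h.trans (add_le_add_right htail _))

end UpperBound

/-! ### Hiding a singleton in a cosliced set. -/

section LowerBound

variable {𝒳 : Type u} {X : Finset 𝒳}

open Classical in
/-- The clustering into `{x}`, with label `i`, and its complement. -/
noncomputable def singletonClustering (i : Fin 2) (x : {x // x ∈ X}) : Clustering X 2 :=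
  fun y => if y = x then i else 1 - i

theorem singletonClustering_injective (i : Fin 2) :
    Function.Injective (singletonClustering (X := X) i) := by
  intro x y h
  have := congrFun h x
  simp only [singletonClustering, if_true] at this
  by_contra hne
  rw [if_neg hne] at this
  revert this
  fin_cases i <;> simp

theorem Coslices.realizedBy_singletonClustering {H : Set (Set 𝒳)}
    (hX : Coslices H (X : Set 𝒳)) (i : Fin 2) (x : {x // x ∈ X}) :
    RealizedBy H (singletonClustering i x) := by
  obtain ⟨⟨h, hh, he⟩, g, hg, ge⟩ := hX x x.2
  intro j
  by_cases hj : j = i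
  · refine ⟨h, hh, ?_⟩
    rw [he]
    subst hj
    ext y
    simp only [Clustering.cluster, singletonClustering, Set.mem_ofPred_eq, Set.mem_singleton_iff]
    have : (1 - j : Fin 2) ≠ j := by fin_cases j <;> simp
    constructor
    · rintro ⟨hy, h'⟩
      by_contra hne
      rw [if_neg fun e => hne (congrArg Subtype.val e)] at h'
      exact this h'
    · rintro rfl
      exact ⟨x.2, by simp⟩
  · refine ⟨g, hg, ?_⟩
    rw [ge]
    ext y
    simp only [Clustering.cluster, singletonClustering, Set.mem_ofPred_eq, Set.mem_singleton_iff,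
      Set.mem_sdiff, Finset.mem_coe]
    have : (1 - i : Fin 2) = j := by
      revert hj; fin_cases j <;> fin_cases i <;> simp
    constructor
    · rintro ⟨hy, h'⟩
      refine ⟨hy, fun e => ?_⟩
      rw [if_pos (Subtype.ext e)] at h'
      exact hj h'.symm
    · rintro ⟨hy, hne⟩
      exact ⟨hy, by rw [if_neg fun e => hne (congrArg Subtype.val e), this]⟩

open Classical in
/-- A deterministic strategy finds at most `M` of the singleton clusterings with fewer than `M`
queries. -/
theorem card_filter_result_singletonClustering_le (s : Strategy X 2) (M : ℕ) :
    (Finset.univ.filter fun x : {x // x ∈ X} =>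
      s.result (singletonClustering 0 x) = singletonClustering 0 x ∧
        s.numQueries (singletonClustering 0 x) < M).card ≤ M := by
  induction s generalizing M with
  | answer D =>
    rcases Nat.eq_zero_or_pos M with rfl | hM
    · simp
    refine le_trans (Finset.card_le_one.2 fun x hx y hy => ?_) hM
    rw [Finset.mem_filter] at hx hy
    -- A leaf returns one clustering, hence is right for at most one hidden point.
    exact singletonClustering_injective 0 (hx.2.1.symm.trans hy.2.1)
  | query z next ih =>
    rcases M with _ | M
    · simp
    -- All hidden points other than `z` answer `1`, so they follow the same branch with one query
    -- less to spend.
    refine (Finset.card_le_card (t := insert z _) fun x hx => ?_).trans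
      ((Finset.card_insert_le _ _).trans (Nat.add_le_add_right (ih 1 M) 1))
    rw [Finset.mem_insert]
    refine or_iff_not_imp_left.2 fun hxz => ?_
    have hz : singletonClustering 0 x z = 1 := by
      simp [singletonClustering, Ne.symm hxz]
    rw [Finset.mem_filter, Strategy.result, Strategy.numQueries, hz] at hx
    exact Finset.mem_filter.2 ⟨Finset.mem_univ _, hx.2.1, by omega⟩

theorem Algorithm.prob_eq_tsum {k : ℕ} (A : Algorithm 𝒳 k) (X : Finset 𝒳)
    (P : Strategy X k → Prop) [DecidablePred P] :
    A.prob X P = ∑' s, A X s * if P s then 1 else 0 := by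
  rw [Algorithm.prob, PMF.toOuterMeasure_apply]
  refine tsum_congr fun s => ?_
  by_cases h : P s <;> simp [h]

/-- This holds for each deterministic strategy: of the hidden points it identifies, at most `M` cost
fewer than `M` queries, and each other one contributes at least `M` to the query sum. -/
theorem sum_prob_singletonClustering_le (A : Algorithm 𝒳 2) (X : Finset 𝒳) (M : ℕ) :
    M * ∑ x : {x // x ∈ X}, A.prob X
        (fun s => s.result (singletonClustering 0 x) = singletonClustering 0 x) ≤
      M * M + ∑ x : {x // x ∈ X}, A.expectedQueries (singletonClustering 0 x) := by
  classical
  simp_rw [Algorithm.prob_eq_tsum, Algorithm.expectedQueries]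
  rw [← Summable.tsum_finsetSum (fun _ _ => ENNReal.summable),
    ← Summable.tsum_finsetSum (fun _ _ => ENNReal.summable), ← ENNReal.tsum_mul_left]
  conv_rhs => rw [← mul_one ((M : ℝ≥0∞) * M), ← (A X).tsum_coe, ← ENNReal.tsum_mul_left,
    ← ENNReal.tsum_add]
  refine ENNReal.tsum_le_tsum fun s => ?_
  rw [← Finset.mul_sum, ← Finset.mul_sum, mul_left_comm, mul_comm _ (A X s), ← mul_add]
  gcongr
  have h1 := card_filter_result_singletonClustering_le s M
  have key : M * (Finset.univ.filter fun x : {x // x ∈ X} =>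
      s.result (singletonClustering 0 x) = singletonClustering 0 x).card ≤
      M * M + ∑ x : {x // x ∈ X}, s.numQueries (singletonClustering 0 x) := by
    have h2 : M * (Finset.univ.filter fun x : {x // x ∈ X} =>
        ¬ s.numQueries (singletonClustering 0 x) < M).card ≤
        ∑ x : {x // x ∈ X}, s.numQueries (singletonClustering 0 x) := by
      rw [mul_comm, ← smul_eq_mul]
      refine (Finset.card_nsmul_le_sum _ (fun x => s.numQueries (singletonClustering 0 x)) M
        fun x hx => ?_).trans (Finset.sum_le_sum_of_subset (Finset.subset_univ _))
      simpa using hx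
    refine le_trans ?_ (add_le_add (Nat.mul_le_mul_left M h1) h2)
    rw [← mul_add]
    refine Nat.mul_le_mul_left M ((Finset.card_le_card fun x hx => ?_).trans
      (Finset.card_union_le _ _))
    simp only [Finset.mem_union, Finset.mem_filter, Finset.mem_univ, true_and] at hx ⊢
    tauto
  rw [Finset.sum_boole]
  exact_mod_cast key

/-- A strategy that makes no query gives the same answer for `C` and `D`, so it is right for at most
one; any other strategy pays at least one query on `C`. -/
theorem prob_add_prob_le (A : Algorithm 𝒳 2) (X : Finset 𝒳)
    (C D : Clustering X 2) (hCD : C ≠ D) :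
    A.prob X (fun s => s.result C = C) + A.prob X (fun s => s.result D = D) ≤
      1 + A.expectedQueries C := by
  classical
  simp_rw [Algorithm.prob_eq_tsum, Algorithm.expectedQueries]
  rw [← ENNReal.tsum_add]
  conv_rhs => rw [← (A X).tsum_coe, ← ENNReal.tsum_add]
  refine ENNReal.tsum_le_tsum fun s => ?_
  rw [← mul_add, ← mul_one_add]
  refine mul_le_mul_right ?_ _
  cases s with
  | answer E =>
    simp only [Strategy.result, Strategy.numQueries]
    by_cases h : E = C
    · simp [h, hCD]
    · by_cases h' : E = D <;> simp_all
  | query x next =>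
    simp only [Strategy.numQueries]
    push_cast
    refine (add_le_add (b := 1) (d := 1) (by split_ifs <;> simp) (by split_ifs <;> simp)).trans ?_
    gcongr
    exact le_add_self

theorem Coslices.exists_expectedQueries_ge {H : Set (Set 𝒳)} (hX : Coslices H (X : Set 𝒳))
    (hH : H.Nonempty) {p : ℝ} (hp : 1 / 2 < p) (A : Algorithm 𝒳 2) (hA : A.Recovers H p) :
    ∃ C : Clustering X 2, RealizedBy H C ∧
      ENNReal.ofReal ((p - 1 / 2) / 3 * X.card) ≤ A.expectedQueries C := by
  rcases Nat.lt_trichotomy X.card 1 with h0 | h1 | h2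
  · have hX0 : X = ∅ := Finset.card_eq_zero.1 (by omega)
    subst hX0
    obtain ⟨h, hh⟩ := hH
    exact ⟨fun _ => 0, fun i => ⟨h, hh, by ext; simp [Clustering.cluster]⟩, by simp⟩
  -- With one point the averaging argument is void, as `n / 2 = 0`. The two labels of the point give
  -- two realized clusterings, which forces at least `2 * p - 1` expected queries.
  · obtain ⟨x, hx⟩ := Finset.card_pos.1 (by omega : 0 < X.card)
    have hne : singletonClustering 0 (⟨x, hx⟩ : {x // x ∈ X}) ≠ singletonClustering 1 ⟨x, hx⟩ := by
      intro h
      have := congrFun h ⟨x, hx⟩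
      simp [singletonClustering] at this
    have hr := fun i => hX.realizedBy_singletonClustering i ⟨x, hx⟩
    refine ⟨_, hr 0, ?_⟩
    have := (add_le_add (hA X _ (hr 0)) (hA X _ (hr 1))).trans
      (prob_add_prob_le A X _ _ hne)
    rw [← ENNReal.ofReal_add (by linarith) (by linarith), ← tsub_le_iff_left,
      ← ENNReal.ofReal_one, ← ENNReal.ofReal_sub _ zero_le_one] at this
    refine (ENNReal.ofReal_le_ofReal ?_).trans this
    rw [h1]
    push_cast
    linarith
  · by_contra! hcon
    set n := X.card with hn
    set M := n / 2 with hM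
    have hne : (Finset.univ : Finset {x // x ∈ X}).Nonempty := by
      obtain ⟨x, hx⟩ := Finset.card_pos.1 (by omega : 0 < X.card)
      exact ⟨⟨x, hx⟩, Finset.mem_univ _⟩
    have hcard : (Finset.univ : Finset {x // x ∈ X}).card = n := by simp [hn]
    have hlt := ENNReal.sum_lt_sum_of_nonempty hne fun x _ =>
      hcon _ (hX.realizedBy_singletonClustering 0 x)
    have hsum := sum_prob_singletonClustering_le A X M
    have hge : (n : ℝ≥0∞) * ENNReal.ofReal p ≤ ∑ x : {x // x ∈ X}, A.prob X
        (fun s => s.result (singletonClustering 0 x) = singletonClustering 0 x) := by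
      have := Finset.card_nsmul_le_sum Finset.univ _ _ fun (x : {x // x ∈ X}) _ =>
        hA X _ (hX.realizedBy_singletonClustering 0 x)
      rwa [hcard, nsmul_eq_mul] at this
    rw [Finset.sum_const, hcard, nsmul_eq_mul] at hlt
    have hfin : (M : ℝ≥0∞) * ((n : ℝ≥0∞) * ENNReal.ofReal p) <
        M * M + n * ENNReal.ofReal ((p - 1 / 2) / 3 * n) := by
      refine (mul_le_mul_right hge _).trans_lt (hsum.trans_lt ?_)
      exact ENNReal.add_lt_add_left (by finiteness) hlt
    have hp0 : 0 ≤ (p - 1 / 2) / 3 * n := mul_nonneg (by linarith) (by positivity)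
    simp only [← ENNReal.ofReal_natCast] at hfin
    rw [← ENNReal.ofReal_mul (by positivity), ← ENNReal.ofReal_mul (by positivity),
      ← ENNReal.ofReal_mul (by positivity), ← ENNReal.ofReal_mul (by positivity),
      ← ENNReal.ofReal_add (by positivity) (by positivity)] at hfin
    have hlt' := (ENNReal.ofReal_lt_ofReal_iff_of_nonneg
      (by have : 0 < p := by linarith
          positivity)).1 hfin
    have hM2 : (2 : ℝ) * M ≤ n := by exact_mod_cast (by omega : 2 * M ≤ n)
    have hM3 : (n : ℝ) ≤ 3 * M := by exact_mod_cast (by omega : n ≤ 3 * M)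
    have e1 : (n : ℝ) * n * (p - 1 / 2) ≤ 3 * M * n * (p - 1 / 2) := by
      have : 0 ≤ p - 1 / 2 := by linarith
      gcongr
    have e2 : (M : ℝ) * (2 * M) ≤ M * n := by gcongr
    -- With `n / 3 ≤ M ≤ n / 2`, the right side of `hlt'` is at most `M * n / 2 + M * n * (p - 1 /
    -- 2) = M * n * p`, its left side. The lower bound on `M`, valid for `n ≥ 2`, is the source of
    -- the `3` in the constant.
    nlinarith

end LowerBound

theorem exists_coslices_card_eq {𝒳 : Type u} {H : Set (Set 𝒳)} {n : ℕ} (hn : (n : ℕ∞) ≤ cosl H) :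
    ∃ X : Finset 𝒳, X.card = n ∧ Coslices H (X : Set 𝒳) := by
  obtain ⟨Z, hZ, hle⟩ : ∃ Z, Coslices H Z ∧ (n : ℕ∞) ≤ Z.encard := by
    by_contra! h
    rcases Nat.eq_zero_or_pos n with rfl | hpos
    · exact absurd (h ∅ (by intro x hx; simp at hx)) (by simp)
    obtain ⟨m, rfl⟩ : ∃ m, n = m + 1 := ⟨n - 1, by omega⟩
    -- If every cosliced set had fewer than `m + 1` points, the supremum would be at most `m`; thus
    -- some cosliced set is large enough, and it can be shrunk to exactly `n` points.
    have : cosl H ≤ m := iSup₂_le fun Z hZ => Order.le_of_lt_add_one (by simpa using h Z hZ)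
    have := hn.trans this
    norm_cast at this
    omega
  obtain ⟨Y, hYZ, hY⟩ := Set.exists_subset_encard_eq hle
  have hfin : Y.Finite := Set.finite_of_encard_eq_coe hY
  refine ⟨hfin.toFinset, ?_, by simpa using hZ.mono hYZ⟩
  rw [hfin.encard_eq_coe_toFinset_card] at hY
  exact_mod_cast hY

theorem nonempty_of_cosl_eq_top {𝒳 : Type u} {H : Set (Set 𝒳)} (hH : cosl H = ⊤) : H.Nonempty := by
  obtain ⟨X, hX, hc⟩ := exists_coslices_card_eq (H := H) (n := 1) (by simp [hH])
  obtain ⟨x, hx⟩ := Finset.card_pos.1 (by omega : 0 < X.card)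
  obtain ⟨⟨h, hh, -⟩, -⟩ := hc x hx
  exact ⟨h, hh⟩

end ActiveClustering

theorem mainTheorem4 :
    -- upper bound; the constants depend only on the exponent in the failure probability
    (∃ K : ℝ → ℝ, ∀ (𝒳 : Type u) (H : Set (Set 𝒳)) (k : ℕ), 1 ≤ k →
      ActiveClustering.cosl H < ⊤ →
      ∃ A : ActiveClustering.Algorithm 𝒳 k,
        ∀ (X : Finset 𝒳) (C : ActiveClustering.Clustering X k), ActiveClustering.RealizedBy H C →
          (∀ s ∈ (A X).support, s.result C = C) ∧
          (2 ≤ X.card → ∀ a : ℝ, 0 < a →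
            ENNReal.ofReal (1 - (X.card : ℝ) ^ (-a)) ≤
              A.prob X (fun s => (s.numQueries C : ℝ) ≤
                K a * ((ActiveClustering.cosl H).toNat : ℝ) * (k : ℝ) * Real.log k *
                  Real.log X.card))) ∧
    -- lower bounds, already for two clusters
    (∀ p : ℝ, 1 / 2 < p → ∃ c : ℝ, 0 < c ∧
      ∀ (𝒳 : Type u) (H : Set (Set 𝒳)) (A : ActiveClustering.Algorithm 𝒳 2), A.Recovers H p →
        (H.Nonempty → ActiveClustering.cosl H < ⊤ →
          ∃ (X : Finset 𝒳) (C : ActiveClustering.Clustering X 2),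
            (X.card : ℕ∞) = ActiveClustering.cosl H ∧ ActiveClustering.RealizedBy H C ∧
            ENNReal.ofReal (c * ((ActiveClustering.cosl H).toNat : ℝ)) ≤ A.expectedQueries C) ∧
        (ActiveClustering.cosl H = ⊤ → ∀ n : ℕ,
          ∃ (X : Finset 𝒳) (C : ActiveClustering.Clustering X 2),
            X.card = n ∧ ActiveClustering.RealizedBy H C ∧
            ENNReal.ofReal (c * (n : ℝ)) ≤ A.expectedQueries C)) := by
  refine ⟨⟨fun a => (a + 3) / Real.log 2 ^ 2, fun 𝒳 H k hk hH =>
    ⟨ActiveClustering.randomOrderAlgorithm H ⟨0, hk⟩, fun X C hC => ⟨fun s hs =>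
      ActiveClustering.result_randomOrderAlgorithm H _ X C hC s hs, fun hX a ha =>
      ActiveClustering.prob_randomOrderAlgorithm H hH _ X C hC hX a ha⟩⟩⟩, fun p hp =>
    ⟨(p - 1 / 2) / 3, by linarith, fun 𝒳 H A hA => ⟨fun hne hH => ?_, fun hH n => ?_⟩⟩⟩
  · obtain ⟨X, hX, hc⟩ := ActiveClustering.exists_coslices_card_eq (H := H)
      (n := (ActiveClustering.cosl H).toNat) (ENat.natCast_toNat_le_self _)
    obtain ⟨C, hC, hE⟩ := hc.exists_expectedQueries_ge hne hp A hA
    exact ⟨X, C, by rw [hX, ENat.natCast_toNat hH.ne], hC, by rwa [hX] at hE⟩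
  · obtain ⟨X, hX, hc⟩ := ActiveClustering.exists_coslices_card_eq (H := H) (n := n) (by simp [hH])
    obtain ⟨C, hC, hE⟩ := hc.exists_expectedQueries_ge
      (ActiveClustering.nonempty_of_cosl_eq_top hH) hp A hA
    exact ⟨X, C, hX, hC, by rwa [hX] at hE⟩
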